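/- Let $a,b,p\in\mathbb{Q}$ with $p>0$, $\sqrt p\notin\mathbb{Q}$ and $a+b\sqrt p>0$, and let $u>v>0$ be real numbers. Consider the closed region of the plane between two concentric homothetic squares with sides $u$ and $v$ (the closed square with side $u$ with the interior of the concentric square with side $v$ removed, the sides of the two squares being parallel). We say that the region can be cut into rectangles with ratio of sides $r$ if it is the union of finitely many closed nondegenerate rectangles with pairwise disjoint interiors, each having two adjacent sides whose lengths are in the ratio $r$, taken in one of the two orders; the rectangles may be of different sizes and in arbitrary position. Then: 1) If $a-b\sqrt p>0$, then the region can be cut into rectangles with ratio of sides $a+b\sqrt p$ if and only if $$\frac{u+v}{u-v}\in\Big\{\,e+f\sqrt p \;:\; e,f\in\mathbb{Q},\ e>0,\ \frac{|f|}{e}\le\frac{|b|}{a}\Big\};$$ 2) If $a-b\sqrt p<0$, then the region can be cut into rectangles with ratio of sides $a+b\sqrt p$ if and only if $$\frac{u+v}{u-v}\in\Big\{\,e+f\sqrt p \;:\; e,f\in\mathbb{Q},\ f>0,\ \frac{|e|}{f}\le\frac{|a|}{b}\Big\}.$$ (In case 1) one has $a>0$, and in case 2) one has $b>0$, so the fractions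 are defined.) -/

import Mathlib

namespace RectCut

/-- The Euclidean plane. -/
abbrev Plane : Type := EuclideanSpace ℝ (Fin 2)

/-- The parallelogram with vertex `P` spanned by the vectors `s` and `t`
(a closed rectangle when `s` and `t` are nonzero and orthogonal). -/
def box (P s t : Plane) : Set Plane :=
  {X | ∃ x ∈ Set.Icc (0 : ℝ) 1, ∃ y ∈ Set.Icc (0 : ℝ) 1, X = P + x • s + y • t}

/-- `T` is a closed nondegenerate rectangle, in arbitrary position in the plane, with ratio of
sides `r`. Since either side may be called `t`, the ratio is taken in one of the two orders. -/
def IsRectangleWithRatio (T : Set Plane) (r : ℝ) : Prop :=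
  ∃ P s t : Plane, s ≠ 0 ∧ t ≠ 0 ∧ inner ℝ s t = 0 ∧ ‖t‖ / ‖s‖ = r ∧ T = box P s t

/-- `M` can be cut into finitely many rectangles with ratio of sides `r`: it is a union of such
rectangles with pairwise disjoint interiors. -/
def CanBeCut (M : Set Plane) (r : ℝ) : Prop :=
  ∃ (n : ℕ) (T : Fin n → Set Plane),
    (∀ i, IsRectangleWithRatio (T i) r) ∧
    (∀ i j, i ≠ j → Disjoint (interior (T i)) (interior (T j))) ∧
    ⋃ i, T i = M

/-- The closed square with centre `c`, sides parallel to the orthogonal unit vectors `d₁`, `d₂`,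
and side length `s`. -/
def square (c d₁ d₂ : Plane) (s : ℝ) : Set Plane :=
  {X | |inner ℝ d₁ (X - c)| ≤ s / 2 ∧ |inner ℝ d₂ (X - c)| ≤ s / 2}

/-- The closed region between two concentric homothetic squares with sides `u > v`. -/
def squareWithHole (c d₁ d₂ : Plane) (u v : ℝ) : Set Plane :=
  square c d₁ d₂ u \ interior (square c d₁ d₂ v)

end RectCut

namespace RectCut

open Filter Topology


/-! Write $q=\sqrt p$, $r=a+bq$, $K=(u+v)/(u-v)$. Both conditions say that $K=\alpha r+\beta/r$ with
rational $\alpha,\beta\ge 0$ not both zero, since $1/r$ is a positive rational multiple of $a-bq$ in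
case 1 and of $bq-a$ in case 2. If $K$ has this form, the region splits as a pinwheel into four
rectangles of ratio $K$, and each is assembled from grids of rectangles of ratio $r$
(`canTile_combination`, `canBeCut_squareWithHole`).

Conversely, the alternating sum of the indicator of a set at the four points
$(x\pm\delta,y\pm\varepsilon)$, with $\varepsilon$ far smaller than $\delta$, defines a charge that
is additive over dissections. A rectangle aligned with the frame has charge $\pm1$ at its corners, a
slanted one has charge zero, so tiles in arbitrary position cost nothing
(`CanBeCut.exists_charges`). Pairing charges with a biadditive $\beta$ turns an aligned tile into
$\beta(\text{width},\text{height})$. Hence if $\beta(w,rw)$ and $\beta(rw,w)$ are never negative,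
then $\beta(v,v)\le\beta(u,u)$ (`CanBeCut.nonneg_of_biadditive`).

Such $\beta$ are symmetric forms in the pairs $(\mu(qx),\mu(x))$, where $\mu$ is $\mathbb{Q}$-linear
with $\mu(u-v)=0$ and $\mu(q(u-v))=1$. The inequality becomes $A\mu(q(u+v))+C\mu(u+v)\ge 0$. If
$K\notin\mathbb{Q}(q)$, the two values of $\mu$ are free and the inequality can be violated. If
$K=e+fq$, it reads $Ae+Cf\ge 0$, and suitable forms give the required bounds (`le_of_admissible`,
`le_of_admissible_sqrt`). -/

/-! ### Rectangles as intersections of four half-planes. -/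

theorem plane_inner (x y : Plane) : inner ℝ x y = x 0 * y 0 + x 1 * y 1 := by
  simp [PiLp.inner_apply, Fin.sum_univ_two, mul_comm]

/-- The determinant of two nonzero orthogonal vectors of the plane does not vanish. -/
theorem det_ne_zero_of_orthogonal {s t : Plane} (hs : s ≠ 0) (ht : t ≠ 0)
    (h : inner ℝ s t = 0) : s 0 * t 1 - s 1 * t 0 ≠ 0 := by
  have h1 : 0 < inner ℝ s s := real_inner_self_pos.2 hs
  have h2 : 0 < inner ℝ t t := real_inner_self_pos.2 ht
  rw [plane_inner] at h h1 h2
  intro h0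
  have := mul_pos h1 h2
  have e : (s 0 * s 0 + s 1 * s 1) * (t 0 * t 0 + t 1 * t 1) =
    (s 0 * t 0 + s 1 * t 1) ^ 2 + (s 0 * t 1 - s 1 * t 0) ^ 2 := by ring
  rw [e, h, h0] at this
  simp at this

theorem eq_zero_of_inner_eq_zero {s t x : Plane} (hs : s ≠ 0) (ht : t ≠ 0)
    (h : inner ℝ s t = 0) (hsx : inner ℝ s x = 0) (htx : inner ℝ t x = 0) : x = 0 := by
  have hdet := det_ne_zero_of_orthogonal hs ht h
  rw [plane_inner] at hsx htx
  have h0 : (s 0 * t 1 - s 1 * t 0) * x 0 = 0 := by linear_combination t 1 * hsx - s 1 * htx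
  have h1 : (s 0 * t 1 - s 1 * t 0) * x 1 = 0 := by linear_combination s 0 * htx - t 0 * hsx
  ext i
  fin_cases i
  · simpa [hdet] using h0
  · simpa [hdet] using h1

theorem mem_box_iff {P s t X : Plane} (hs : s ≠ 0) (ht : t ≠ 0) (h : inner ℝ s t = 0) :
    X ∈ box P s t ↔ (0 ≤ inner ℝ s (X - P) ∧ 0 ≤ inner ℝ s s - inner ℝ s (X - P)) ∧
      0 ≤ inner ℝ t (X - P) ∧ 0 ≤ inner ℝ t t - inner ℝ t (X - P) := by
  have h1 : 0 < inner ℝ s s := real_inner_self_pos.2 hs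
  have h2 : 0 < inner ℝ t t := real_inner_self_pos.2 ht
  have h' : inner ℝ t s = 0 := by rwa [real_inner_comm]
  constructor
  · rintro ⟨x, ⟨hx0, hx1⟩, y, ⟨hy0, hy1⟩, rfl⟩
    have e : P + x • s + y • t - P = x • s + y • t := by abel
    rw [e]
    simp only [inner_add_right, inner_smul_right, h, h', mul_zero, add_zero, zero_add]
    refine ⟨⟨by positivity, ?_⟩, by positivity, ?_⟩ <;> nlinarith
  · rintro ⟨⟨a1, a2⟩, a3, a4⟩
    refine ⟨inner ℝ s (X - P) / inner ℝ s s, ⟨by positivity, ?_⟩,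
      inner ℝ t (X - P) / inner ℝ t t, ⟨by positivity, ?_⟩, ?_⟩
    · rw [div_le_one h1]; linarith
    · rw [div_le_one h2]; linarith
    · rw [← sub_eq_zero]
      refine eq_zero_of_inner_eq_zero hs ht h ?_ ?_
      · rw [sub_add_eq_sub_sub, sub_add_eq_sub_sub, inner_sub_right, inner_sub_right (y := X - P),
          inner_smul_right, inner_smul_right, h, div_mul_cancel₀ _ h1.ne']
        ring
      · rw [sub_add_eq_sub_sub, sub_add_eq_sub_sub, inner_sub_right, inner_sub_right (y := X - P),
          inner_smul_right, inner_smul_right, h', div_mul_cancel₀ _ h2.ne']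
        ring

theorem mem_interior_box {P s t X : Plane} (hs : s ≠ 0) (ht : t ≠ 0) (h : inner ℝ s t = 0)
    (hX : X ∈ box P s t) (h1 : inner ℝ s (X - P) ≠ 0)
    (h2 : inner ℝ s s - inner ℝ s (X - P) ≠ 0) (h3 : inner ℝ t (X - P) ≠ 0)
    (h4 : inner ℝ t t - inner ℝ t (X - P) ≠ 0) : X ∈ interior (box P s t) := by
  rw [mem_box_iff hs ht h] at hX
  obtain ⟨⟨a1, a2⟩, a3, a4⟩ := hX
  have ho : IsOpen {X : Plane | (0 < inner ℝ s (X - P) ∧ 0 < inner ℝ s s - inner ℝ s (X - P)) ∧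
      0 < inner ℝ t (X - P) ∧ 0 < inner ℝ t t - inner ℝ t (X - P)} := by
    have hc : ∀ w : Plane, Continuous fun X : Plane => (inner ℝ w (X - P) : ℝ) := fun w => by
      fun_prop
    exact ((isOpen_lt continuous_const (hc s)).inter
      (isOpen_lt continuous_const (continuous_const.sub (hc s)))).inter
      ((isOpen_lt continuous_const (hc t)).inter
      (isOpen_lt continuous_const (continuous_const.sub (hc t))))
  refine interior_maximal ?_ ho ⟨⟨lt_of_le_of_ne a1 h1.symm, lt_of_le_of_ne a2 h2.symm⟩,
    lt_of_le_of_ne a3 h3.symm, lt_of_le_of_ne a4 h4.symm⟩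
  rintro Y ⟨⟨b1, b2⟩, b3, b4⟩
  rw [mem_box_iff hs ht h]
  exact ⟨⟨b1.le, b2.le⟩, b3.le, b4.le⟩

/-! ### Generic points near a given point. -/

/-- The point with coordinates `x`, `y` in the frame `c`, `d₁`, `d₂`. -/
def point (c d₁ d₂ : Plane) (x y : ℝ) : Plane := c + x • d₁ + y • d₂

theorem inner_point_sub (c d₁ d₂ s P : Plane) (x y : ℝ) :
    inner ℝ s (point c d₁ d₂ x y - P) =
      inner ℝ s (c - P) + inner ℝ s d₁ * x + inner ℝ s d₂ * y := by
  have e : point c d₁ d₂ x y - P = (c - P) + x • d₁ + y • d₂ := by rw [point]; abel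
  rw [e, inner_add_right, inner_add_right, inner_smul_right, inner_smul_right]
  ring

/-- Small horizontal displacements `δ` together with vertical displacements `ε`
that are small in comparison. -/
def cornerFilter : Filter (ℝ × ℝ) := (𝓝[>] (0 : ℝ)).curry (𝓝[>] (0 : ℝ))

theorem eventually_cornerFilter {q : ℝ × ℝ → Prop} :
    (∀ᶠ d in cornerFilter, q d) ↔ ∀ᶠ δ in 𝓝[>] (0 : ℝ), ∀ᶠ ε in 𝓝[>] (0 : ℝ), q (δ, ε) :=
  eventually_curry_iff

instance : cornerFilter.NeBot := by
  refine ⟨fun h => ?_⟩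
  have h' : ∀ᶠ d in cornerFilter, False := by rw [h]; exact eventually_bot
  rw [eventually_cornerFilter] at h'
  simp only [eventually_const] at h'

theorem eventually_fst {q : ℝ → Prop} (h : ∀ᶠ δ in 𝓝[>] (0 : ℝ), q δ) :
    ∀ᶠ d in cornerFilter, q d.1 :=
  eventually_cornerFilter.2 (h.mono fun _ h => Eventually.of_forall fun _ => h)

theorem eventually_snd {q : ℝ → Prop} (h : ∀ᶠ δ in 𝓝[>] (0 : ℝ), q δ) :
    ∀ᶠ d in cornerFilter, q d.2 :=
  eventually_cornerFilter.2 (Eventually.of_forall fun _ => h)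

theorem eventually_affine_ne {A : ℝ} (hA : A ≠ 0) (k : ℝ) :
    ∀ᶠ ε in 𝓝[>] (0 : ℝ), k + A * ε ≠ 0 := by
  by_cases hk : k = 0
  · filter_upwards [self_mem_nhdsWithin] with ε hε
    simp [hk, hA, (Set.mem_Ioi.1 hε).ne']
  · have hc : Continuous fun ε : ℝ => k + A * ε := by fun_prop
    exact (hc.continuousAt.eventually_ne (by simpa using hk)).filter_mono nhdsWithin_le_nhds

/-- A non-vertical line is avoided by choosing `ε` after `δ`; a vertical one is avoided by `δ`
alone. Boundaries of tiles can therefore be ignored. -/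
theorem eventually_line_ne {A B : ℝ} (h : A ≠ 0 ∨ B ≠ 0) (k x y : ℝ) {σ τ : ℝ} (hσ : σ ≠ 0)
    (hτ : τ ≠ 0) : ∀ᶠ d in cornerFilter, k + A * (x + σ * d.1) + B * (y + τ * d.2) ≠ 0 := by
  rw [eventually_cornerFilter]
  by_cases hB : B = 0
  · have hA : A ≠ 0 := by tauto
    filter_upwards [eventually_affine_ne (mul_ne_zero hA hσ) (k + A * x)] with δ hδ
    refine Eventually.of_forall fun ε => ?_
    convert hδ using 1
    rw [hB]; ring
  · refine Eventually.of_forall fun δ => ?_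
    filter_upwards [eventually_affine_ne (mul_ne_zero hB hτ) (k + A * (x + σ * δ) + B * y)]
      with ε hε
    convert hε using 1
    ring

/-- Crossing a horizontal line does not change the side with respect to a non-horizontal line. -/
theorem eventually_side_iff {A : ℝ} (hA : A ≠ 0) (B k x y : ℝ) {σ : ℝ} (hσ : σ ≠ 0) :
    ∀ᶠ d in cornerFilter, (0 ≤ k + A * (x + σ * d.1) + B * (y + -1 * d.2) ↔
      0 ≤ k + A * (x + σ * d.1) + B * (y + 1 * d.2)) := by
  rw [eventually_cornerFilter]
  -- A non-horizontal line meets the horizontal line through `y` only once, so for small `δ` the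
  -- point at height `y` is off it; continuity then handles every sufficiently small `ε`.
  filter_upwards [eventually_affine_ne (mul_ne_zero hA hσ) (k + A * x + B * y)] with δ hδ
  have hz : k + A * (x + σ * δ) + B * y ≠ 0 := by
    convert hδ using 1
    ring
  have c1 : Continuous fun ε : ℝ => k + A * (x + σ * δ) + B * (y + -1 * ε) := by fun_prop
  have c2 : Continuous fun ε : ℝ => k + A * (x + σ * δ) + B * (y + 1 * ε) := by fun_prop
  rcases hz.lt_or_gt with hz | hz
  · have e1 := (c1.continuousAt (x := 0)).eventually_lt_const (show _ < (0 : ℝ) by simpa using hz)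
    have e2 := (c2.continuousAt (x := 0)).eventually_lt_const (show _ < (0 : ℝ) by simpa using hz)
    refine Eventually.filter_mono nhdsWithin_le_nhds ?_
    filter_upwards [e1, e2] with ε h1 h2
    exact ⟨fun h => absurd h (not_le.2 h1), fun h => absurd h (not_le.2 h2)⟩
  · have e1 := (c1.continuousAt (x := 0)).eventually_const_lt (show (0 : ℝ) < _ by simpa using hz)
    have e2 := (c2.continuousAt (x := 0)).eventually_const_lt (show (0 : ℝ) < _ by simpa using hz)
    refine Eventually.filter_mono nhdsWithin_le_nhds ?_
    filter_upwards [e1, e2] with ε h1 h2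
    exact ⟨fun _ => h2.le, fun _ => h1.le⟩

open Classical in
/-- The indicator of a proposition, as a real number. -/
noncomputable def ind (q : Prop) : ℝ := if q then 1 else 0

theorem ind_false : ind False = 0 := if_neg id

theorem ind_and (q r : Prop) : ind (q ∧ r) = ind q * ind r := by
  by_cases hq : q <;> by_cases hr : r <;> simp [ind, hq, hr]

/-- The indicator of `x` lying in the interval `[a, b]` drops by `1` at `b` and by `-1` at `a`. -/
theorem eventually_Icc_jump {a b : ℝ} (hab : a < b) (x : ℝ) :
    ∀ᶠ δ in 𝓝[>] (0 : ℝ),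
      ind (x + -1 * δ ∈ Set.Icc a b) - ind (x + 1 * δ ∈ Set.Icc a b) =
        ind (b = x) - ind (a = x) := by
  have key : ∀ z : ℝ, ∀ᶠ δ in 𝓝[>] (0 : ℝ), (z < x → z < x - δ) ∧ (x < z → x + δ < z) := by
    intro z
    have c1 : Continuous fun δ : ℝ => x - δ := by fun_prop
    have c2 : Continuous fun δ : ℝ => x + δ := by fun_prop
    refine Eventually.filter_mono nhdsWithin_le_nhds (Eventually.and ?_ ?_)
    · by_cases h : z < x
      · filter_upwards [(c1.continuousAt (x := 0)).eventually_const_lt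
          (show z < _ by simpa using h)] with δ hδ using fun _ => hδ
      · exact Eventually.of_forall fun _ h' => absurd h' h
    · by_cases h : x < z
      · filter_upwards [(c2.continuousAt (x := 0)).eventually_lt_const
          (show _ < z by simpa using h)] with δ hδ using fun _ => hδ
      · exact Eventually.of_forall fun _ h' => absurd h' h
  filter_upwards [key a, key b, self_mem_nhdsWithin] with δ ha hb hδ
  have hδ : 0 < δ := hδ
  have e1 : x + -1 * δ ∈ Set.Icc a b ↔ a < x ∧ x ≤ b := by
    constructor
    · rintro ⟨h1, h2⟩
      exact ⟨by linarith, le_of_not_gt fun h => by linarith [hb.1 h]⟩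
    · rintro ⟨h1, h2⟩
      exact ⟨by linarith [ha.1 h1], by linarith⟩
  have e2 : x + 1 * δ ∈ Set.Icc a b ↔ a ≤ x ∧ x < b := by
    constructor
    · rintro ⟨h1, h2⟩
      exact ⟨le_of_not_gt fun h => by linarith [ha.2 h], by linarith⟩
    · rintro ⟨h1, h2⟩
      exact ⟨by linarith, by linarith [hb.2 h2]⟩
  simp only [e1, e2, ind]
  rcases lt_trichotomy x a with h | rfl | h
  · simp [not_lt.2 h.le, not_le.2 h, (h.trans hab).ne', h.ne']
  · simp [hab, hab.ne']
  · rcases lt_trichotomy x b with h' | rfl | h'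
    · simp [h, h.le, h', h'.le, h'.ne', h.ne]
    · simp [h, h.ne]
    · simp [not_lt.2 h'.le, not_le.2 h', h'.ne, h.ne]


/-! ### Coordinate rectangles in an orthonormal frame. -/

/-- The closed rectangle `[x₀, x₁] × [y₀, y₁]` in the coordinates given by `c`, `d₁`, `d₂`. -/
def rect (c d₁ d₂ : Plane) (x₀ x₁ y₀ y₁ : ℝ) : Set Plane :=
  {X | inner ℝ d₁ (X - c) ∈ Set.Icc x₀ x₁ ∧ inner ℝ d₂ (X - c) ∈ Set.Icc y₀ y₁}

theorem square_eq_rect (c d₁ d₂ : Plane) (s : ℝ) :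
    square c d₁ d₂ s = rect c d₁ d₂ (-(s / 2)) (s / 2) (-(s / 2)) (s / 2) := by
  ext X
  simp only [square, rect, Set.mem_ofPred_eq, abs_le, Set.mem_Icc]

theorem isOpenMap_inner_sub {d : Plane} (hd : d ≠ 0) (c : Plane) :
    IsOpenMap fun X : Plane => (inner ℝ d (X - c) : ℝ) := by
  have h1 : IsOpenMap (innerSL ℝ d : Plane →L[ℝ] ℝ) := by
    refine ContinuousLinearMap.isOpenMap _ fun y => ⟨(y / inner ℝ d d) • d, ?_⟩
    rw [innerSL_apply_apply, inner_smul_right, div_mul_cancel₀ _ (real_inner_self_pos.2 hd).ne']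
  exact h1.comp (Homeomorph.subRight c).isOpenMap

theorem interior_rect {d₁ d₂ : Plane} (hd₁ : d₁ ≠ 0) (hd₂ : d₂ ≠ 0) (c : Plane)
    (x₀ x₁ y₀ y₁ : ℝ) :
    interior (rect c d₁ d₂ x₀ x₁ y₀ y₁) =
      {X | inner ℝ d₁ (X - c) ∈ Set.Ioo x₀ x₁ ∧ inner ℝ d₂ (X - c) ∈ Set.Ioo y₀ y₁} := by
  have e : rect c d₁ d₂ x₀ x₁ y₀ y₁ =
      (fun X : Plane => (inner ℝ d₁ (X - c) : ℝ)) ⁻¹' Set.Icc x₀ x₁ ∩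
      (fun X : Plane => (inner ℝ d₂ (X - c) : ℝ)) ⁻¹' Set.Icc y₀ y₁ := rfl
  rw [e, interior_inter,
    ← (isOpenMap_inner_sub hd₁ c).preimage_interior_eq_interior_preimage (by fun_prop),
    ← (isOpenMap_inner_sub hd₂ c).preimage_interior_eq_interior_preimage (by fun_prop),
    interior_Icc, interior_Icc]
  rfl

/-- Orthonormal pairs of directions in the plane. -/
structure Frame (d₁ d₂ : Plane) : Prop where
  left : inner ℝ d₁ d₁ = (1 : ℝ)
  right : inner ℝ d₂ d₂ = (1 : ℝ)
  ortho : inner ℝ d₁ d₂ = (0 : ℝ)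

namespace Frame

variable {d₁ d₂ : Plane}

theorem symm (h : Frame d₁ d₂) : Frame d₂ d₁ :=
  ⟨h.right, h.left, by rw [real_inner_comm, h.ortho]⟩

theorem left_ne (h : Frame d₁ d₂) : d₁ ≠ 0 := by
  rintro rfl
  simpa using h.left

theorem right_ne (h : Frame d₁ d₂) : d₂ ≠ 0 := h.symm.left_ne

theorem inner_left_point (h : Frame d₁ d₂) (c : Plane) (x y : ℝ) :
    inner ℝ d₁ (point c d₁ d₂ x y - c) = x := by
  rw [inner_point_sub, h.left, h.ortho]; simp

theorem inner_right_point (h : Frame d₁ d₂) (c : Plane) (x y : ℝ) :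
    inner ℝ d₂ (point c d₁ d₂ x y - c) = y := by
  rw [inner_point_sub, h.right, h.symm.ortho]; simp

theorem ne_zero_of_ne (h : Frame d₁ d₂) {s : Plane} (hs : s ≠ 0) :
    inner ℝ s d₁ ≠ 0 ∨ inner ℝ s d₂ ≠ 0 := by
  by_contra! hc
  refine hs (eq_zero_of_inner_eq_zero h.left_ne h.right_ne h.ortho ?_ ?_)
  · rw [real_inner_comm]; exact hc.1
  · rw [real_inner_comm]; exact hc.2

theorem eq_smul_left (h : Frame d₁ d₂) {s : Plane} (hs : inner ℝ s d₂ = 0) :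
    s = (inner ℝ s d₁ : ℝ) • d₁ := by
  rw [← sub_eq_zero]
  refine eq_zero_of_inner_eq_zero h.left_ne h.right_ne h.ortho ?_ ?_
  · rw [inner_sub_right, inner_smul_right, h.left, real_inner_comm]; ring
  · rw [inner_sub_right, inner_smul_right, h.symm.ortho, real_inner_comm, hs]; ring

theorem point_mem_rect (h : Frame d₁ d₂) (c : Plane) (x₀ x₁ y₀ y₁ x y : ℝ) :
    point c d₁ d₂ x y ∈ rect c d₁ d₂ x₀ x₁ y₀ y₁ ↔ x ∈ Set.Icc x₀ x₁ ∧ y ∈ Set.Icc y₀ y₁ := by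
  simp only [rect, Set.mem_ofPred_eq, h.inner_left_point, h.inner_right_point]

theorem norm_left (h : Frame d₁ d₂) : ‖d₁‖ = 1 := by
  rw [← sq_eq_sq₀ (norm_nonneg _) one_pos.le, ← real_inner_self_eq_norm_sq, h.left, one_pow]

end Frame

/-! ### Corner charges. -/

/-- The alternating sum of the indicator of `q` over the four points `(x ± δ, y ± ε)`. -/
noncomputable def cornerSum (q : ℝ → ℝ → Prop) (x y : ℝ) (d : ℝ × ℝ) : ℝ :=
  ind (q (x + -1 * d.1) (y + -1 * d.2)) -
  ind (q (x + 1 * d.1) (y + -1 * d.2)) -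
  ind (q (x + -1 * d.1) (y + 1 * d.2)) +
  ind (q (x + 1 * d.1) (y + 1 * d.2))

/-- The four corners of a rectangle, with signs. -/
noncomputable def rectCharge (x₀ x₁ y₀ y₁ : ℝ) : ℝ × ℝ →₀ ℝ :=
  Finsupp.single (x₁, y₁) 1 - Finsupp.single (x₀, y₁) 1 - Finsupp.single (x₁, y₀) 1 +
    Finsupp.single (x₀, y₀) 1

/-- `χ` gives the alternating sums of the indicator of `q` near each point. -/
def HasCharge (q : ℝ → ℝ → Prop) (χ : ℝ × ℝ →₀ ℝ) : Prop :=
  ∀ x y, ∀ᶠ d in cornerFilter, cornerSum q x y d = χ (x, y)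

/-- The indicator is a product of two one-variable indicators, so the alternating sum is the product
of their jumps. -/
theorem hasCharge_Icc {x₀ x₁ y₀ y₁ : ℝ} (hx : x₀ < x₁) (hy : y₀ < y₁) {q : ℝ → ℝ → Prop}
    (hq : ∀ x y, q x y ↔ x ∈ Set.Icc x₀ x₁ ∧ y ∈ Set.Icc y₀ y₁) :
    HasCharge q (rectCharge x₀ x₁ y₀ y₁) := by
  intro x y
  filter_upwards [eventually_fst (eventually_Icc_jump hx x),
    eventually_snd (eventually_Icc_jump hy y)] with d h1 h2
  have l : cornerSum q x y d =
    (ind (x + -1 * d.1 ∈ Set.Icc x₀ x₁) -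
      ind (x + 1 * d.1 ∈ Set.Icc x₀ x₁)) *
    (ind (y + -1 * d.2 ∈ Set.Icc y₀ y₁) -
      ind (y + 1 * d.2 ∈ Set.Icc y₀ y₁)) := by
    simp only [cornerSum, hq, ind_and]
    ring
  rw [l, h1, h2]
  have e : ∀ a b : ℝ, Finsupp.single (a, b) (1 : ℝ) (x, y) = ind (a = x) * ind (b = y) := by
    intro a b
    rw [← ind_and, ← Prod.mk.injEq, Finsupp.single_apply, ind]
    congr
  simp only [rectCharge, Finsupp.add_apply, Finsupp.sub_apply, e]
  ring

/-- No boundary line is horizontal, so moving from `y - ε` to `y + ε` changes no membership and the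
four terms cancel in vertical pairs. This is where the order of the two limits matters. -/
theorem hasCharge_zero_of_slanted {A₁ A₂ A₃ A₄ : ℝ} (h₁ : A₁ ≠ 0) (h₂ : A₂ ≠ 0) (h₃ : A₃ ≠ 0)
    (h₄ : A₄ ≠ 0) (B₁ B₂ B₃ B₄ k₁ k₂ k₃ k₄ : ℝ) {q : ℝ → ℝ → Prop}
    (hq : ∀ x y, q x y ↔ (0 ≤ k₁ + A₁ * x + B₁ * y ∧ 0 ≤ k₂ + A₂ * x + B₂ * y) ∧
      0 ≤ k₃ + A₃ * x + B₃ * y ∧ 0 ≤ k₄ + A₄ * x + B₄ * y) : HasCharge q 0 := by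
  intro x y
  have key : ∀ σ : ℝ, σ ≠ 0 → ∀ᶠ d in cornerFilter,
      (q (x + σ * d.1) (y + -1 * d.2) ↔ q (x + σ * d.1) (y + 1 * d.2)) := by
    intro σ hσ
    filter_upwards [eventually_side_iff h₁ B₁ k₁ x y hσ, eventually_side_iff h₂ B₂ k₂ x y hσ,
      eventually_side_iff h₃ B₃ k₃ x y hσ, eventually_side_iff h₄ B₄ k₄ x y hσ] with d e1 e2 e3 e4
    rw [hq, hq, e1, e2, e3, e4]
  filter_upwards [key (-1) (by norm_num), key 1 (by norm_num)] with d h1 h2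
  simp only [cornerSum, h1, h2, Finsupp.coe_zero, Pi.zero_apply]
  ring

/-- If the indicators of `q i` add up to that of `q'` at generic points, so do the charges. -/
theorem HasCharge.sum_eq {ι : Type*} [Fintype ι] {q : ι → ℝ → ℝ → Prop} {q₁ q₂ : ℝ → ℝ → Prop}
    {χ : ι → ℝ × ℝ →₀ ℝ} {χ₁ χ₂ : ℝ × ℝ →₀ ℝ} (h : ∀ i, HasCharge (q i) (χ i))
    (h₁ : HasCharge q₁ χ₁) (h₂ : HasCharge q₂ χ₂)
    (hs : ∀ x y σ τ : ℝ, σ ≠ 0 → τ ≠ 0 → ∀ᶠ d in cornerFilter,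
            ∑ i, ind (q i (x + σ * d.1) (y + τ * d.2)) =
      ind (q₁ (x + σ * d.1) (y + τ * d.2)) -
      ind (q₂ (x + σ * d.1) (y + τ * d.2))) :
    ∑ i, χ i = χ₁ - χ₂ := by
  ext ⟨x, y⟩
  have hm : (-1 : ℝ) ≠ 0 := by norm_num
  have hd : ∀ᶠ d in cornerFilter, (∑ i, χ i) (x, y) = (χ₁ - χ₂) (x, y) := by
    filter_upwards [eventually_all.2 fun i => h i x y, h₁ x y, h₂ x y,
      hs x y _ _ hm hm, hs x y _ _ hm one_ne_zero, hs x y _ _ one_ne_zero hm,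
      hs x y _ _ one_ne_zero one_ne_zero] with d e0 e1 e2 f1 f2 f3 f4
    rw [Finsupp.finsetSum_apply, Finsupp.sub_apply, ← e1, ← e2,
      Finset.sum_congr rfl fun i _ => (e0 i).symm]
    simp only [cornerSum, Finset.sum_add_distrib, Finset.sum_sub_distrib, f1, f2, f3, f4]
    ring
  -- The asserted equality does not depend on `d`, so nontriviality of `cornerFilter` suffices.
  exact hd.exists.choose_spec


/-! ### Charges of the tiles and of the whole dissection. -/

theorem box_comm (P s t : Plane) : box P s t = box P t s := by
  ext X
  constructor <;> rintro ⟨x, hx, y, hy, rfl⟩ <;> exact ⟨y, hy, x, hx, by abel⟩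

theorem nonneg_mul_iff {w : ℝ} (hw : w ≠ 0) (z : ℝ) :
    (0 ≤ w * z ∧ 0 ≤ w * w - w * z) ↔ min 0 w ≤ z ∧ z ≤ max 0 w := by
  have e : w * w - w * z = w * (w - z) := by ring
  rw [e]
  rcases hw.lt_or_gt with h | h
  · rw [min_eq_right h.le, max_eq_left h.le, ← neg_mul_neg, ← neg_mul_neg w (w - z),
      mul_nonneg_iff_of_pos_left (neg_pos.2 h), mul_nonneg_iff_of_pos_left (neg_pos.2 h),
      neg_sub, sub_nonneg, neg_nonneg, and_comm]
  · rw [min_eq_left h.le, max_eq_right h.le, mul_nonneg_iff_of_pos_left h,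
      mul_nonneg_iff_of_pos_left h, sub_nonneg]

variable {d₁ d₂ : Plane}

theorem Frame.box_smul (hF : Frame d₁ d₂) (c P : Plane) {w h : ℝ} (hw : w ≠ 0) (hh : h ≠ 0) :
    box P (w • d₁) (h • d₂) = rect c d₁ d₂
      (inner ℝ d₁ (P - c) + min 0 w) (inner ℝ d₁ (P - c) + max 0 w)
      (inner ℝ d₂ (P - c) + min 0 h) (inner ℝ d₂ (P - c) + max 0 h) := by
  ext X
  have e : ∀ d : Plane, (inner ℝ d (X - P) : ℝ) = inner ℝ d (X - c) - inner ℝ d (P - c) := by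
    intro d
    rw [← inner_sub_right, sub_sub_sub_cancel_right]
  rw [mem_box_iff (smul_ne_zero hw hF.left_ne) (smul_ne_zero hh hF.right_ne)
    (by rw [inner_smul_left, inner_smul_right, hF.ortho]; simp)]
  simp only [inner_smul_left, inner_smul_right, hF.left, hF.right, RCLike.conj_to_real, mul_one,
    nonneg_mul_iff hw, nonneg_mul_iff hh, rect, Set.mem_ofPred_eq, Set.mem_Icc]
  rw [e, e, le_sub_iff_add_le', sub_le_iff_le_add', le_sub_iff_add_le', sub_le_iff_le_add']

/-- Generic points of a rectangle in arbitrary position are interior. -/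
theorem IsRectangleWithRatio.eventually_interior (hF : Frame d₁ d₂) (c : Plane) {T : Set Plane}
    {r : ℝ} (hT : IsRectangleWithRatio T r) (x y : ℝ) {σ τ : ℝ} (hσ : σ ≠ 0) (hτ : τ ≠ 0) :
    ∀ᶠ d in cornerFilter, point c d₁ d₂ (x + σ * d.1) (y + τ * d.2) ∈ T →
      point c d₁ d₂ (x + σ * d.1) (y + τ * d.2) ∈ interior T := by
  obtain ⟨P, s, t, hs, ht, hst, -, rfl⟩ := hT
  have key : ∀ w : Plane, w ≠ 0 → ∀ k : ℝ, ∀ᶠ d in cornerFilter,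
      k - inner ℝ w (point c d₁ d₂ (x + σ * d.1) (y + τ * d.2) - P) ≠ 0 := by
    intro w hw k
    filter_upwards [eventually_line_ne (hF.ne_zero_of_ne hw) (inner ℝ w (c - P) - k) x y hσ hτ]
      with d hd h0
    apply hd
    rw [inner_point_sub] at h0
    linear_combination -h0
  filter_upwards [key s hs 0, key s hs (inner ℝ s s), key t ht 0, key t ht (inner ℝ t t)]
    with d h1 h2 h3 h4 hX
  rw [zero_sub, neg_ne_zero] at h1 h3
  exact mem_interior_box hs ht hst hX h1 h2 h3 h4

/-- The charge of a rectangle vanishes unless its sides are parallel to `d₁`, `d₂`. -/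
theorem IsRectangleWithRatio.exists_charge (hF : Frame d₁ d₂) (c : Plane) {T : Set Plane}
    {r : ℝ} (hT : IsRectangleWithRatio T r) :
    ∃ χ, HasCharge (fun x y => point c d₁ d₂ x y ∈ T) χ ∧ (χ = 0 ∨ ∃ x₀ x₁ y₀ y₁,
      x₀ < x₁ ∧ y₀ < y₁ ∧ (y₁ - y₀ = r * (x₁ - x₀) ∨ x₁ - x₀ = r * (y₁ - y₀)) ∧
      χ = rectCharge x₀ x₁ y₀ y₁) := by
  obtain ⟨P, s, t, hs, ht, hst, hr, rfl⟩ := hT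
  have n1 : ‖d₁‖ = 1 := hF.norm_left
  have n2 : ‖d₂‖ = 1 := hF.symm.norm_left
  have hlt : ∀ w : ℝ, w ≠ 0 → ∀ p : ℝ, p + min 0 w < p + max 0 w := fun w hw p => by
    rcases hw.lt_or_gt with h | h <;> simp [h, h.le]
  have hdiff : ∀ w p : ℝ, p + max 0 w - (p + min 0 w) = |w| := fun w p => by
    rw [add_sub_add_left_eq_sub, max_sub_min_eq_abs, sub_zero]
  have aligned : ∀ w h : ℝ, w ≠ 0 → h ≠ 0 → (|h| = r * |w| ∨ |w| = r * |h|) →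
      ∃ χ, HasCharge (fun x y => point c d₁ d₂ x y ∈ box P (w • d₁) (h • d₂)) χ ∧
      (χ = 0 ∨ ∃ x₀ x₁ y₀ y₁, x₀ < x₁ ∧ y₀ < y₁ ∧
        (y₁ - y₀ = r * (x₁ - x₀) ∨ x₁ - x₀ = r * (y₁ - y₀)) ∧ χ = rectCharge x₀ x₁ y₀ y₁) := by
    intro w h hw hh hwh
    refine ⟨_, hasCharge_Icc (hlt w hw (inner ℝ d₁ (P - c))) (hlt h hh (inner ℝ d₂ (P - c)))
      fun x y => ?_, Or.inr ⟨_, _, _, _, hlt w hw _, hlt h hh _, ?_, rfl⟩⟩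
    · rw [hF.box_smul c P hw hh, hF.point_mem_rect]
    · rwa [hdiff, hdiff]
  have hrst : ‖t‖ = r * ‖s‖ := by rw [← hr, div_mul_cancel₀ _ (norm_ne_zero_iff.2 hs)]
  have hts : inner ℝ t s = (0 : ℝ) := by rw [real_inner_comm, hst]
  have perp : ∀ {e₁ e₂ s t : Plane}, Frame e₁ e₂ → s ≠ 0 → inner ℝ s t = (0 : ℝ) →
      inner ℝ s e₂ = (0 : ℝ) → inner ℝ t e₁ = (0 : ℝ) := by
    intro e₁ e₂ s t hE hs hst h2
    have h1 : (inner ℝ s e₁ : ℝ) ≠ 0 := by simpa [h2] using hE.ne_zero_of_ne hs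
    rw [hE.eq_smul_left h2, inner_smul_left, real_inner_comm t] at hst
    simpa [h1] using hst
  by_cases h2 : inner ℝ s d₂ = (0 : ℝ)
  · have h1 := perp hF hs hst h2
    have es := hF.eq_smul_left h2
    have et := hF.symm.eq_smul_left h1
    generalize (inner ℝ s d₁ : ℝ) = w at es
    generalize (inner ℝ t d₂ : ℝ) = h at et
    subst es et
    refine aligned w h (by rintro rfl; simp at hs) (by rintro rfl; simp at ht) (Or.inl ?_)
    simpa [norm_smul, n1, n2] using hrst
  by_cases h1 : inner ℝ s d₁ = (0 : ℝ)
  · have h2 := perp hF.symm hs hst h1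
    have es := hF.symm.eq_smul_left h1
    have et := hF.eq_smul_left h2
    generalize (inner ℝ s d₂ : ℝ) = h at es
    generalize (inner ℝ t d₁ : ℝ) = w at et
    subst es et
    rw [box_comm]
    refine aligned w h (by rintro rfl; simp at ht) (by rintro rfl; simp at hs) (Or.inr ?_)
    simpa [norm_smul, n1, n2] using hrst
  -- Neither spanning vector is parallel to the frame, so all four sides lie on non-horizontal
  -- lines.
  · have h3 : inner ℝ t d₁ ≠ (0 : ℝ) := fun h => h2 (perp hF.symm ht hts h)
    refine ⟨0, hasCharge_zero_of_slanted h1 (neg_ne_zero.2 h1) h3 (neg_ne_zero.2 h3)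
      (inner ℝ s d₂) (-inner ℝ s d₂) (inner ℝ t d₂) (-inner ℝ t d₂)
      (inner ℝ s (c - P)) (inner ℝ s s - inner ℝ s (c - P))
      (inner ℝ t (c - P)) (inner ℝ t t - inner ℝ t (c - P)) fun x y => ?_, Or.inl rfl⟩
    rw [mem_box_iff hs ht hst, inner_point_sub, inner_point_sub]
    refine and_congr (and_congr Iff.rfl ?_) (and_congr Iff.rfl ?_)
    · rw [show ∀ a b c d : ℝ, a - (b + c + d) = a - b - c - d by intros; ring]
      simp only [neg_mul, sub_eq_add_neg]
    · rw [show ∀ a b c d : ℝ, a - (b + c + d) = a - b - c - d by intros; ring]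
      simp only [neg_mul, sub_eq_add_neg]

/-- The charges of the pieces of a dissected square with a hole add up to its charge. -/
theorem CanBeCut.exists_charges (hF : Frame d₁ d₂) {c : Plane} {u v r : ℝ} (hv : 0 < v)
    (huv : v < u) (h : CanBeCut (squareWithHole c d₁ d₂ u v) r) :
    ∃ (n : ℕ) (χ : Fin n → ℝ × ℝ →₀ ℝ),
      (∀ i, χ i = 0 ∨ ∃ x₀ x₁ y₀ y₁, x₀ < x₁ ∧ y₀ < y₁ ∧
        (y₁ - y₀ = r * (x₁ - x₀) ∨ x₁ - x₀ = r * (y₁ - y₀)) ∧ χ i = rectCharge x₀ x₁ y₀ y₁) ∧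
      ∑ i, χ i = rectCharge (-(u / 2)) (u / 2) (-(u / 2)) (u / 2) -
        rectCharge (-(v / 2)) (v / 2) (-(v / 2)) (v / 2) := by
  obtain ⟨n, T, hT, hdisj, hU⟩ := h
  choose χ hχ hχ' using fun i => (hT i).exists_charge hF c
  refine ⟨n, χ, hχ', HasCharge.sum_eq hχ
    (q₁ := fun x y => point c d₁ d₂ x y ∈ square c d₁ d₂ u)
    (q₂ := fun x y => point c d₁ d₂ x y ∈ square c d₁ d₂ v)
    (hasCharge_Icc (by linarith) (by linarith) fun x y => by
      rw [square_eq_rect, hF.point_mem_rect])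
    (hasCharge_Icc (by linarith) (by linarith) fun x y => by
      rw [square_eq_rect, hF.point_mem_rect]) fun x y σ τ hσ hτ => ?_⟩
  -- Besides the tile boundaries, the four lines bounding the hole are avoided, so it no longer
  -- matters that only the interior of the inner square was removed.
  filter_upwards [eventually_all.2 fun i => (hT i).eventually_interior hF c x y hσ hτ,
    eventually_line_ne (A := 1) (B := 0) (by simp) (v / 2) x y hσ hτ,
    eventually_line_ne (A := 1) (B := 0) (by simp) (-(v / 2)) x y hσ hτ,
    eventually_line_ne (A := 0) (B := 1) (by simp) (v / 2) x y hσ hτ,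
    eventually_line_ne (A := 0) (B := 1) (by simp) (-(v / 2)) x y hσ hτ]
    with d hint g1 g2 g3 g4
  generalize x + σ * d.1 = x' at *
  generalize y + τ * d.2 = y' at *
  have hM : point c d₁ d₂ x' y' ∈ squareWithHole c d₁ d₂ u v ↔
      point c d₁ d₂ x' y' ∈ square c d₁ d₂ u ∧ point c d₁ d₂ x' y' ∉ square c d₁ d₂ v := by
    rw [squareWithHole, Set.mem_sdiff]
    refine and_congr_right fun _ => not_congr ?_
    refine ⟨fun h => interior_subset h, fun h => ?_⟩
    rw [square_eq_rect, hF.point_mem_rect] at h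
    rw [square_eq_rect, interior_rect hF.left_ne hF.right_ne, Set.mem_ofPred_eq,
      hF.inner_left_point, hF.inner_right_point]
    obtain ⟨⟨a1, a2⟩, a3, a4⟩ := h
    refine ⟨⟨lt_of_le_of_ne a1 ?_, lt_of_le_of_ne a2 ?_⟩,
      lt_of_le_of_ne a3 ?_, lt_of_le_of_ne a4 ?_⟩ <;> rintro h
    · apply g1; linarith
    · apply g2; linarith
    · apply g3; linarith
    · apply g4; linarith
  have hvu : point c d₁ d₂ x' y' ∈ square c d₁ d₂ v → point c d₁ d₂ x' y' ∈ square c d₁ d₂ u := by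
    rintro ⟨a1, a2⟩
    exact ⟨by linarith, by linarith⟩
  have hR : ind (point c d₁ d₂ x' y' ∈ square c d₁ d₂ u) -
      ind (point c d₁ d₂ x' y' ∈ square c d₁ d₂ v) =
      ind (point c d₁ d₂ x' y' ∈ squareWithHole c d₁ d₂ u v) := by
    rw [hM]
    by_cases a : point c d₁ d₂ x' y' ∈ square c d₁ d₂ v
    · simp [ind, a, hvu a]
    · simp only [a, not_false_eq_true, and_true, ind_false, sub_zero]
  rw [hR, ← hU]
  by_cases hX : point c d₁ d₂ x' y' ∈ ⋃ i, T i
  · obtain ⟨i, hi⟩ := Set.mem_iUnion.1 hX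
    rw [Finset.sum_eq_single i]
    · simp [ind, hX, hi]
    · intro j _ hj
      exact if_neg fun h =>
        Set.disjoint_left.1 (hdisj j i hj) (hint j h) (hint i hi)
    · simp
  · have : ∀ i, point c d₁ d₂ x' y' ∉ T i := fun i h => hX (Set.mem_iUnion.2 ⟨i, h⟩)
    simp [ind, hX, this]

/-- Extending `β` linearly to charges sends the four signed corners of a rectangle to `β` of its
side lengths. Applied to the additivity of charges, this writes `β u u - β v v` as a sum of
nonnegative tile contributions. -/
theorem CanBeCut.nonneg_of_biadditive (hF : Frame d₁ d₂) {c : Plane} {u v r : ℝ} (hv : 0 < v)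
    (huv : v < u) (h : CanBeCut (squareWithHole c d₁ d₂ u v) r) {β : ℝ → ℝ → ℝ}
    (hl : ∀ x x' y, β (x - x') y = β x y - β x' y) (hr : ∀ x y y', β x (y - y') = β x y - β x y')
    (h1 : ∀ w, 0 ≤ β w (r * w)) (h2 : ∀ w, 0 ≤ β (r * w) w) : β v v ≤ β u u := by
  obtain ⟨n, χ, hχ, hsum⟩ := h.exists_charges hF hv huv
  have hΛ : ∀ x₀ x₁ y₀ y₁, Finsupp.linearCombination ℝ (fun Z : ℝ × ℝ => β Z.1 Z.2)
      (rectCharge x₀ x₁ y₀ y₁) = β (x₁ - x₀) (y₁ - y₀) := by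
    intro x₀ x₁ y₀ y₁
    simp only [rectCharge, map_add, map_sub, Finsupp.linearCombination_single, one_smul, hl, hr]
    ring
  have e := congrArg (Finsupp.linearCombination ℝ (fun Z : ℝ × ℝ => β Z.1 Z.2)) hsum
  rw [map_sum, map_sub, hΛ, hΛ] at e
  have e0 : ∀ z : ℝ, z / 2 - -(z / 2) = z := fun z => by ring
  rw [e0, e0] at e
  rw [← sub_nonneg, ← e]
  refine Finset.sum_nonneg fun i _ => ?_
  rcases hχ i with h0 | ⟨x₀, x₁, y₀, y₁, -, -, hr | hr, h0⟩
  · rw [h0, map_zero]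
  · rw [h0, hΛ, hr]; exact h1 _
  · rw [h0, hΛ, hr]; exact h2 _


/-! ### Bilinear forms that are nonnegative on tiles. -/

/-- The symmetric bilinear form on `ℚ(√p)` with matrix `A, C, C, D` is nonnegative on all pairs
`(x, (a + b√p) x)`; here `p = P`. -/
def Admissible (a b P A C D : ℝ) : Prop :=
  ∀ X Y : ℝ, 0 ≤ (A * a + C * b) * X ^ 2 + (A * P * b + 2 * C * a + D * b) * (X * Y) +
    (C * P * b + D * a) * Y ^ 2

/-- The form is the rational part of the product in $\mathbb{Q}(\sqrt p)$; completing the square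
reduces positivity to that of the norm of $a+b\sqrt p$. -/
theorem admissible_trace {a b P : ℝ} (ha : 0 < a) (hP : 0 < P) (hN : P * b ^ 2 < a ^ 2) :
    Admissible a b P 1 0 P := by
  intro X Y
  refine nonneg_of_mul_nonneg_right (a := a) ?_ ha
  have h : 0 ≤ P * (a ^ 2 - P * b ^ 2) * Y ^ 2 :=
    mul_nonneg (mul_nonneg hP.le (by linarith)) (sq_nonneg Y)
  nlinarith [sq_nonneg (a * X + P * b * Y)]

/-- Here the form is the coefficient of $\sqrt p$ in the product, which takes over when the norm is
negative. -/
theorem admissible_trace_sqrt {a b P : ℝ} (hb : 0 < b) (hN : a ^ 2 < P * b ^ 2) :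
    Admissible a b P 0 1 0 := by
  intro X Y
  refine nonneg_of_mul_nonneg_right (a := b) ?_ hb
  have h : 0 ≤ (P * b ^ 2 - a ^ 2) * Y ^ 2 := mul_nonneg (by linarith) (sq_nonneg Y)
  nlinarith [sq_nonneg (b * X + a * Y)]

theorem le_of_admissible {a b P e f : ℝ} (ha : 0 < a) (hN : P * b ^ 2 < a ^ 2)
    (H : ∀ A C D, Admissible a b P A C D → 0 ≤ A * e + C * f) : a * |f| ≤ |b| * e := by
  rcases eq_or_ne b 0 with rfl | hb
  · have hf : f = 0 := by
      -- With slope `k = (e + 1) / f` the form gives `a * (X - k * Y) ^ 2`, while `A * e + C * f`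
      -- equals `-1`.
      by_contra hf
      have := H 1 (-((e + 1) / f)) (((e + 1) / f) ^ 2) fun X Y => by
        have : 0 ≤ a * (X - (e + 1) / f * Y) ^ 2 := by positivity
        nlinarith
      rw [neg_mul, div_mul_cancel₀ _ hf] at this
      linarith
    simp [hf]
  -- The two forms have quadratic parts of rank one: `2a(bX + aY)²` here and `2a(a² - Pb²)Y²` below.
  -- They yield the two signs in the bound on `|f|`.
  · have h1 := H (b ^ 2) (a * b) (2 * a ^ 2 - P * b ^ 2) fun X Y => by
      have : 0 ≤ 2 * a * (b * X + a * Y) ^ 2 := by positivity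
      linarith
    have h2 := H (b ^ 2) (-(a * b)) (2 * a ^ 2 - P * b ^ 2) fun X Y => by
      have : 0 ≤ 2 * a * (a ^ 2 - P * b ^ 2) * Y ^ 2 :=
        mul_nonneg (mul_nonneg (by linarith) (by linarith)) (sq_nonneg Y)
      linarith
    refine le_of_mul_le_mul_left ?_ (abs_pos.2 hb)
    have h3 : |a * b * f| ≤ b ^ 2 * e := abs_le.2 ⟨by linarith, by linarith⟩
    rw [abs_mul, abs_mul, abs_of_pos ha, ← sq_abs b] at h3
    linarith

theorem le_of_admissible_sqrt {a b P e f : ℝ} (hb : 0 < b) (hN : a ^ 2 < P * b ^ 2)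
    (H : ∀ A C D, Admissible a b P A C D → 0 ≤ A * e + C * f) : b * |e| ≤ |a| * f := by
  -- The sign `s` makes one formula cover both signs of `a`: the quadratic part is `2|a|(bX + aY)²`
  -- here and `2|a|(Pb² - a²)Y²` in `neg`. Taking `s = 1` and `s = -1` uses one of each.
  have pos : ∀ s : ℝ, s * a = |a| →
      Admissible a b P (s * b ^ 2) (|a| * b) (s * (2 * a ^ 2 - P * b ^ 2)) := by
    intro s h X Y
    have h1 : 0 ≤ 2 * |a| * (b * X + a * Y) ^ 2 := by positivity
    rw [← h] at h1 ⊢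
    linarith
  have neg : ∀ s : ℝ, s * a = -|a| →
      Admissible a b P (s * b ^ 2) (|a| * b) (s * (2 * a ^ 2 - P * b ^ 2)) := by
    intro s h X Y
    have h1 : 0 ≤ |a| * (P * b ^ 2 - a ^ 2) * (2 * Y ^ 2) :=
      mul_nonneg (mul_nonneg (abs_nonneg a) (by linarith)) (by positivity)
    have h' : |a| = -(s * a) := by linarith
    rw [h'] at h1 ⊢
    linarith
  have both : 0 ≤ 1 * b ^ 2 * e + |a| * b * f ∧ 0 ≤ -1 * b ^ 2 * e + |a| * b * f := by
    rcases abs_cases a with ⟨h, -⟩ | ⟨h, -⟩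
    · exact ⟨H _ _ _ (pos 1 (by linarith)),
        H _ _ _ (neg (-1) (by linarith))⟩
    · exact ⟨H _ _ _ (neg 1 (by linarith)),
        H _ _ _ (pos (-1) (by linarith))⟩
  refine le_of_mul_le_mul_left ?_ hb
  have h3 : |b ^ 2 * e| ≤ |a| * b * f := abs_le.2 ⟨by linarith, by linarith⟩
  rw [abs_mul, abs_of_pos (pow_pos hb 2)] at h3
  linarith

/-! ### Rational-linear functionals and the necessary condition. -/

theorem eq_zero_of_add_mul_irrational {q : ℝ} (hq : Irrational q) {g h : ℚ}
    (H : (g : ℝ) + h * q = 0) : g = 0 ∧ h = 0 := by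
  have hh : h = 0 := by
    by_contra hh
    refine hq ⟨-g / h, ?_⟩
    have : (h : ℝ) ≠ 0 := by exact_mod_cast hh
    push_cast
    field_simp
    linarith
  subst hh
  simpa using H

theorem exists_linearMap_of_linearIndependent {n : ℕ} {v : Fin n → ℝ}
    (hv : LinearIndependent ℚ v) (z : Fin n → ℝ) : ∃ μ : ℝ →ₗ[ℚ] ℝ, ∀ i, μ (v i) = z i := by
  obtain ⟨g, hg⟩ := LinearMap.exists_leftInverse_of_injective
    (Fintype.linearCombination ℚ v) (LinearMap.ker_eq_bot.2
      (linearIndependent_iff_injective_fintypeLinearCombination.1 hv))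
  refine ⟨Fintype.linearCombination ℚ z ∘ₗ g, fun i => ?_⟩
  have h := LinearMap.congr_fun hg (Pi.single i 1)
  simp only [LinearMap.comp_apply, Fintype.linearCombination_apply_single, one_smul,
    LinearMap.id_apply] at h
  rw [LinearMap.comp_apply, h, Fintype.linearCombination_apply_single, one_smul]

theorem exists_functional {q t : ℝ} (hq : Irrational q) (ht : t ≠ 0) :
    ∃ μ : ℝ →ₗ[ℚ] ℝ, μ t = 0 ∧ μ (q * t) = 1 := by
  have hv : LinearIndependent ℚ ![t, q * t] := by
    rw [LinearIndependent.pair_iff]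
    intro g h H
    rw [Rat.smul_def, Rat.smul_def] at H
    refine eq_zero_of_add_mul_irrational hq (mul_right_cancel₀ ht ?_)
    linear_combination H
  obtain ⟨μ, hμ⟩ := exists_linearMap_of_linearIndependent hv ![0, 1]
  exact ⟨μ, by simpa using hμ 0, by simpa using hμ 1⟩

theorem exists_functional_of_forall_ne {p : ℚ} {q s t : ℝ} (hq : Irrational q) (hqp : q * q = p)
    (ht : t ≠ 0) (hst : ∀ e f : ℚ, s ≠ (e + f * q) * t) (e f : ℝ) :
    ∃ μ : ℝ →ₗ[ℚ] ℝ, (μ t = 0 ∧ μ (q * t) = 1) ∧ μ s = f ∧ μ (q * s) = e := by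
  have hv : LinearIndependent ℚ ![t, q * t, s, q * s] := by
    rw [Fintype.linearIndependent_iff]
    intro g H
    simp only [Fin.sum_univ_four, Rat.smul_def, Matrix.cons_val] at H
    have H' : ((g 0 : ℝ) + g 1 * q) * t + (g 2 + g 3 * q) * s = 0 := by linear_combination H
    have h23 : g 2 = 0 ∧ g 3 = 0 := by
      by_contra hne
      have hN : (g 2 + g 3 * q : ℝ) ≠ 0 := fun h => hne (eq_zero_of_add_mul_irrational hq h)
      have hN' : (g 2 + (-g 3 : ℚ) * q : ℝ) ≠ 0 := fun h => hne (by
        simpa using eq_zero_of_add_mul_irrational hq h)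
      have hM : ((g 2 ^ 2 - p * g 3 ^ 2 : ℚ) : ℝ) = (g 2 + g 3 * q) * (g 2 + (-g 3 : ℚ) * q) := by
        push_cast
        rw [← hqp]; ring
      have hM0 : ((g 2 ^ 2 - p * g 3 ^ 2 : ℚ) : ℝ) ≠ 0 := by rw [hM]; exact mul_ne_zero hN hN'
      -- These are the coordinates of `-(g 0 + g 1 * q) / (g 2 + g 3 * q)`, obtained by multiplying
      -- through by the conjugate of the denominator.
      refine hst (-(g 0 * g 2 - p * g 1 * g 3) / (g 2 ^ 2 - p * g 3 ^ 2))
        (-(g 1 * g 2 - g 0 * g 3) / (g 2 ^ 2 - p * g 3 ^ 2)) ?_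
      refine mul_left_cancel₀ hM0 ?_
      rw [Rat.cast_div, Rat.cast_div]
      generalize hm : ((g 2 ^ 2 - p * g 3 ^ 2 : ℚ) : ℝ) = M at *
      field_simp
      rw [hM]
      push_cast
      rw [← hqp]
      linear_combination (g 2 - g 3 * q) * H'
    obtain ⟨h2, h3⟩ := h23
    have h01 : g 0 = 0 ∧ g 1 = 0 := by
      refine eq_zero_of_add_mul_irrational hq (mul_right_cancel₀ ht ?_)
      rw [h2, h3] at H'
      simpa using H'
    intro i
    fin_cases i
    exacts [h01.1, h01.2, h2, h3]
  obtain ⟨μ, hμ⟩ := exists_linearMap_of_linearIndependent hv ![0, 1, f, e]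
  exact ⟨μ, ⟨by simpa using hμ 0, by simpa using hμ 1⟩, by simpa using hμ 2, by simpa using hμ 3⟩

/-- The symmetric form `β` is evaluated on the coordinates `(μ (q * x), μ x)`. By symmetry `β u u -
β v v = β (u - v) (u + v)`, and `u - v` has coordinates `(1, 0)`, so `D` drops out. -/
theorem CanBeCut.nonneg_of_functional (hF : Frame d₁ d₂) {c : Plane} {u v : ℝ} {a b p : ℚ} {q : ℝ}
    (hqp : q * q = p) (hv : 0 < v) (huv : v < u)
    (h : CanBeCut (squareWithHole c d₁ d₂ u v) (a + b * q)) {A C D : ℝ}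
    (hA : Admissible a b p A C D) (μ : ℝ →ₗ[ℚ] ℝ) (h0 : μ (u - v) = 0)
    (h1 : μ (q * (u - v)) = 1) : 0 ≤ A * μ (q * (u + v)) + C * μ (u + v) := by
  have hn : ∀ w, μ ((a + b * q) * w) = a * μ w + b * μ (q * w) := by
    intro w
    rw [show (a + b * q) * w = a • w + b • (q * w) by rw [Rat.smul_def, Rat.smul_def]; ring,
      map_add, map_smul, map_smul, Rat.smul_def, Rat.smul_def]
  have hm : ∀ w, μ (q * ((a + b * q) * w)) = a * μ (q * w) + b * p * μ w := by
    intro w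
    rw [show q * ((a + b * q) * w) = a • (q * w) + (b * p) • w by
        rw [Rat.smul_def, Rat.smul_def, Rat.cast_mul, ← hqp]; ring,
      map_add, map_smul, map_smul, Rat.smul_def, Rat.smul_def, Rat.cast_mul]
  have key := h.nonneg_of_biadditive hF hv huv
    (β := fun x y => A * (μ (q * x) * μ (q * y)) + C * (μ (q * x) * μ y + μ x * μ (q * y)) +
      D * (μ x * μ y))
    (fun x x' y => by simp only [mul_sub, map_sub]; ring)
    (fun x y y' => by simp only [mul_sub, map_sub]; ring)
    (fun w => by
      rw [hn, hm]
      have := hA (μ (q * w)) (μ w)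
      linarith)
    (fun w => by
      rw [hn, hm]
      have := hA (μ (q * w)) (μ w)
      linarith)
  rw [map_sub, sub_eq_zero] at h0
  rw [mul_sub, map_sub, sub_eq_iff_eq_add] at h1
  simp only [h0, h1] at key
  rw [mul_add, map_add, map_add, h0, h1]
  linarith

theorem CanBeCut.exists_ratio (hF : Frame d₁ d₂) {c : Plane} {u v : ℝ} {a b p : ℚ} {q : ℝ}
    (hq : Irrational q) (hqp : q * q = p) (hv : 0 < v) (huv : v < u)
    (h : CanBeCut (squareWithHole c d₁ d₂ u v) (a + b * q)) {A₀ C₀ D₀ : ℝ}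
    (h₀ : Admissible a b p A₀ C₀ D₀) (hne : 0 < A₀ ^ 2 + C₀ ^ 2) :
    ∃ e f : ℚ, (u + v) / (u - v) = e + f * q ∧
      ∀ A C D, Admissible a b p A C D → 0 ≤ A * e + C * f := by
  have ht : u - v ≠ 0 := (sub_pos.2 huv).ne'
  by_cases hst : ∃ e f : ℚ, u + v = (e + f * q) * (u - v)
  · obtain ⟨e, f, hef⟩ := hst
    refine ⟨e, f, (div_eq_iff ht).2 hef, fun A C D hA => ?_⟩
    obtain ⟨μ, h0, h1⟩ := exists_functional hq ht
    have key := h.nonneg_of_functional hF hqp hv huv hA μ h0 h1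
    have e1 : μ (u + v) = f := by
      rw [hef, show (e + f * q) * (u - v) = e • (u - v) + f • (q * (u - v)) by
        rw [Rat.smul_def, Rat.smul_def]; ring, map_add, map_smul, map_smul, h0, h1,
        Rat.smul_def, Rat.smul_def]
      ring
    have e2 : μ (q * (u + v)) = e := by
      rw [hef, show q * ((e + f * q) * (u - v)) = e • (q * (u - v)) + (f * p) • (u - v) by
        rw [Rat.smul_def, Rat.smul_def, Rat.cast_mul, ← hqp]; ring, map_add, map_smul, map_smul,
        h0, h1, Rat.smul_def, Rat.smul_def]
      ring
    rwa [e1, e2] at key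
  · push Not at hst
    exfalso
    -- The prescribed values turn the inequality into `0 ≤ -(A₀ ^ 2 + C₀ ^ 2)`.
    obtain ⟨μ, ⟨h0, h1⟩, h2, h3⟩ :=
      exists_functional_of_forall_ne hq hqp ht hst (-A₀) (-C₀)
    have key := h.nonneg_of_functional hF hqp hv huv h₀ μ h0 h1
    rw [h2, h3] at key
    linarith


/-! ### Constructing dissections. -/

theorem CanBeCut.union {M N : Set Plane} {r : ℝ} (hM : CanBeCut M r) (hN : CanBeCut N r)
    (hMN : Disjoint (interior M) N) : CanBeCut (M ∪ N) r := by
  obtain ⟨m, T, hT, hTd, rfl⟩ := hM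
  obtain ⟨n, T', hT', hTd', rfl⟩ := hN
  have hd : ∀ i j, Disjoint (interior (T i)) (interior (T' j)) := fun i j =>
    hMN.mono (interior_mono (Set.subset_iUnion T i))
      (interior_subset.trans (Set.subset_iUnion T' j))
  refine ⟨m + n, Fin.append T T', fun i => ?_, fun i j => ?_, ?_⟩
  · induction i using Fin.addCases with
    | left i => simpa using hT i
    | right i => simpa using hT' i
  · induction i using Fin.addCases with
    | left i =>
      induction j using Fin.addCases with
      | left j => simpa using hTd i j
      | right j => simpa using fun _ => hd i j
    | right i =>
      induction j using Fin.addCases with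
      | left j => simpa using fun _ => (hd j i).symm
      | right j => simpa using hTd' i j
  · ext X
    simp only [Set.mem_iUnion, Set.mem_union]
    constructor
    · rintro ⟨i, hi⟩
      induction i using Fin.addCases with
      | left i => exact Or.inl ⟨i, by simpa using hi⟩
      | right i => exact Or.inr ⟨i, by simpa using hi⟩
    · rintro (⟨i, hi⟩ | ⟨i, hi⟩)
      · exact ⟨Fin.castAdd n i, by simpa using hi⟩
      · exact ⟨Fin.natAdd m i, by simpa using hi⟩

/-- Every `w × h` rectangle with sides parallel to `d₁`, `d₂` can be cut into rectangles with
ratio of sides `r`. -/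
def CanTile (d₁ d₂ : Plane) (r w h : ℝ) : Prop :=
  ∀ c x y, CanBeCut (rect c d₁ d₂ x (x + w) y (y + h)) r

theorem rect_swap (c d₁ d₂ : Plane) (x₀ x₁ y₀ y₁ : ℝ) :
    rect c d₁ d₂ x₀ x₁ y₀ y₁ = rect c d₂ d₁ y₀ y₁ x₀ x₁ :=
  Set.ext fun _ => and_comm

variable {r w h : ℝ}

theorem CanTile.swap (H : CanTile d₁ d₂ r w h) : CanTile d₂ d₁ r h w := fun c x y => by
  rw [rect_swap]
  exact H c y x

theorem canTile_self (hF : Frame d₁ d₂) (hr : 0 < r) (hw : 0 < w) : CanTile d₁ d₂ r w (r * w) := by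
  intro c x y
  have hh : 0 < r * w := mul_pos hr hw
  refine ⟨1, fun _ => rect c d₁ d₂ x (x + w) y (y + r * w), fun _ => ?_, fun i j hij =>
    absurd (Subsingleton.elim i j) hij, Set.iUnion_const _⟩
  have n1 : ‖d₁‖ = 1 := hF.norm_left
  have n2 : ‖d₂‖ = 1 := hF.symm.norm_left
  refine ⟨point c d₁ d₂ x y, w • d₁, (r * w) • d₂, smul_ne_zero hw.ne' hF.left_ne,
    smul_ne_zero hh.ne' hF.right_ne, ?_, ?_, ?_⟩
  · rw [inner_smul_left, inner_smul_right, hF.ortho]; simp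
  · rw [norm_smul, norm_smul, n1, n2, mul_one, mul_one, Real.norm_of_nonneg hw.le,
      Real.norm_of_nonneg hh.le, mul_div_cancel_right₀ _ hw.ne']
  · rw [hF.box_smul c _ hw.ne' hh.ne', hF.inner_left_point, hF.inner_right_point,
      min_eq_left hw.le, max_eq_right hw.le, min_eq_left hh.le, max_eq_right hh.le, add_zero,
      add_zero]

theorem CanTile.add (hF : Frame d₁ d₂) {w' : ℝ} (hw : 0 ≤ w) (hw' : 0 ≤ w')
    (H : CanTile d₁ d₂ r w h) (H' : CanTile d₁ d₂ r w' h) : CanTile d₁ d₂ r (w + w') h := by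
  intro c x y
  have e : rect c d₁ d₂ x (x + (w + w')) y (y + h) =
      rect c d₁ d₂ x (x + w) y (y + h) ∪ rect c d₁ d₂ (x + w) (x + w + w') y (y + h) := by
    ext X
    simp only [rect, Set.mem_ofPred_eq, Set.mem_union, ← or_and_right]
    rw [← Set.mem_union, Set.Icc_union_Icc_eq_Icc (by linarith) (by linarith), add_assoc]
  rw [e]
  refine (H c x y).union (H' c (x + w) y) ?_
  rw [interior_rect hF.left_ne hF.right_ne, Set.disjoint_left]
  rintro X ⟨⟨-, h1⟩, -⟩ ⟨⟨h2, -⟩, -⟩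
  linarith

theorem CanTile.succ_mul (hF : Frame d₁ d₂) (hw : 0 ≤ w) (H : CanTile d₁ d₂ r w h) (n : ℕ) :
    CanTile d₁ d₂ r ((n + 1 : ℕ) * w) h := by
  induction n with
  | zero => simpa using H
  | succ n ih =>
    rw [Nat.cast_succ, add_mul, one_mul]
    exact ih.add hF (by positivity) hw H

/-- For `α = (m + 1) / (n + 1)` the rectangle is a grid, `m + 1` across and `n + 1` up, of copies of
the `s × t` rectangle shrunk by the factor `n + 1`. -/
theorem CanTile.rat_mul (hF : Frame d₁ d₂) {α : ℚ} (hα : 0 < α) {s t : ℝ} (hs : 0 < s)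
    (H : ∀ l : ℝ, 0 < l → CanTile d₁ d₂ r (l * s) (l * t)) (ht : 0 < t) :
    CanTile d₁ d₂ r (α * s) t := by
  obtain ⟨m, hm⟩ : ∃ m : ℕ, α.num = (m + 1 : ℕ) :=
    ⟨α.num.toNat - 1, by have := Rat.num_pos.2 hα; omega⟩
  obtain ⟨n, hn⟩ : ∃ n : ℕ, α.den = n + 1 := ⟨α.den - 1, by have := α.pos; omega⟩
  have hn0 : (0 : ℝ) < (n + 1 : ℕ) := by positivity
  have hα' : (α : ℝ) = (m + 1 : ℕ) / (n + 1 : ℕ) := by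
    rw [Rat.cast_def, hm, hn, Int.cast_natCast]
  have h1 := H ((n + 1 : ℕ) : ℝ)⁻¹ (inv_pos.2 hn0)
  have h2 := ((h1.succ_mul hF (by positivity) m).swap.succ_mul hF.symm (by positivity) n).swap
  rw [mul_inv_cancel_left₀ hn0.ne'] at h2
  rwa [hα', div_eq_mul_inv, mul_assoc]

/-- Rectangles whose ratio is a nonnegative rational combination of `r` and `1 / r` can be cut
into rectangles with ratio of sides `r`. -/
theorem canTile_combination (hF : Frame d₁ d₂) (hr : 0 < r) {α β : ℚ} (hα : 0 ≤ α) (hβ : 0 ≤ β)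
    (hαβ : 0 < α + β) {t : ℝ} (ht : 0 < t) : CanTile d₁ d₂ r ((α * r + β * r⁻¹) * t) t := by
  have h1 : 0 < α → CanTile d₁ d₂ r (α * (r * t)) t := fun hα =>
    CanTile.rat_mul hF hα (mul_pos hr ht) (fun l hl => by
      rw [mul_left_comm]
      exact (canTile_self hF.symm hr (mul_pos hl ht)).swap) ht
  have h2 : 0 < β → CanTile d₁ d₂ r (β * (r⁻¹ * t)) t := fun hβ =>
    CanTile.rat_mul hF hβ (by positivity) (fun l hl => by
      have := canTile_self hF hr (w := l * (r⁻¹ * t)) (by positivity)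
      rwa [mul_left_comm r, mul_inv_cancel_left₀ hr.ne'] at this) ht
  rw [add_mul, mul_assoc, mul_assoc]
  rcases hα.eq_or_lt with rfl | hα'
  · simpa using h2 (by simpa using hαβ)
  rcases hβ.eq_or_lt with rfl | hβ'
  · simpa using h1 hα'
  · exact (h1 hα').add hF (by positivity) (by positivity) (h2 hβ')

/-- A square with a hole can be cut into four rectangles of sides `(u + v) / 2`, `(u - v) / 2`. -/
theorem canBeCut_squareWithHole (hF : Frame d₁ d₂) (c : Plane) {u v : ℝ} (hv : 0 < v)
    (huv : v < u) (h₁ : CanTile d₁ d₂ r ((u + v) / 2) ((u - v) / 2))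
    (h₂ : CanTile d₂ d₁ r ((u + v) / 2) ((u - v) / 2)) :
    CanBeCut (squareWithHole c d₁ d₂ u v) r := by
  have r1 := h₁ c (-(u / 2)) (v / 2)
  have r2 := h₂.swap c (v / 2) (-(v / 2))
  have r3 := h₁ c (-(v / 2)) (-(u / 2))
  have r4 := h₂.swap c (-(u / 2)) (-(u / 2))
  have e : squareWithHole c d₁ d₂ u v =
      rect c d₁ d₂ (-(u / 2)) (-(u / 2) + (u + v) / 2) (v / 2) (v / 2 + (u - v) / 2) ∪
      (rect c d₁ d₂ (v / 2) (v / 2 + (u - v) / 2) (-(v / 2)) (-(v / 2) + (u + v) / 2) ∪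
      (rect c d₁ d₂ (-(v / 2)) (-(v / 2) + (u + v) / 2) (-(u / 2)) (-(u / 2) + (u - v) / 2) ∪
      rect c d₁ d₂ (-(u / 2)) (-(u / 2) + (u - v) / 2) (-(u / 2)) (-(u / 2) + (u + v) / 2))) := by
    ext X
    rw [squareWithHole, square_eq_rect, square_eq_rect, interior_rect hF.left_ne hF.right_ne]
    simp only [rect, Set.mem_sdiff, Set.mem_union, Set.mem_ofPred_eq, Set.mem_Icc, Set.mem_Ioo]
    generalize (inner ℝ d₁ (X - c) : ℝ) = x
    generalize (inner ℝ d₂ (X - c) : ℝ) = y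
    constructor
    · rintro ⟨⟨⟨a1, a2⟩, a3, a4⟩, hn⟩
      by_cases b1 : v / 2 ≤ y
      · rcases le_total x (v / 2) with b2 | b2
        · exact Or.inl ⟨⟨by linarith, by linarith⟩, by linarith, by linarith⟩
        · exact Or.inr (Or.inl ⟨⟨by linarith, by linarith⟩, by linarith, by linarith⟩)
      by_cases b2 : v / 2 ≤ x
      · rcases le_total (-(v / 2)) y with b3 | b3
        · exact Or.inr (Or.inl ⟨⟨by linarith, by linarith⟩, by linarith, by linarith⟩)
        · exact Or.inr (Or.inr (Or.inl ⟨⟨by linarith, by linarith⟩, by linarith, by linarith⟩))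
      push Not at b1 b2
      rcases le_total x (-(v / 2)) with b3 | b3
      · exact Or.inr (Or.inr (Or.inr ⟨⟨by linarith, by linarith⟩, by linarith, by linarith⟩))
      · by_cases b4 : y ≤ -(v / 2)
        · exact Or.inr (Or.inr (Or.inl ⟨⟨by linarith, by linarith⟩, by linarith, by linarith⟩))
        · push Not at b4
          rcases b3.eq_or_lt with b5 | b5
          · exact Or.inr (Or.inr (Or.inr ⟨⟨by linarith, by linarith⟩, by linarith, by linarith⟩))
          · exact absurd ⟨⟨b5, b2⟩, b4, b1⟩ hn
    · rintro (⟨⟨a1, a2⟩, a3, a4⟩ | ⟨⟨a1, a2⟩, a3, a4⟩ | ⟨⟨a1, a2⟩, a3, a4⟩ | ⟨⟨a1, a2⟩, a3, a4⟩) <;>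
        refine ⟨⟨⟨by linarith, by linarith⟩, by linarith, by linarith⟩, ?_⟩ <;>
        rintro ⟨⟨b1, b2⟩, b3, b4⟩ <;> linarith
  rw [e]
  refine r1.union (r2.union (r3.union r4 ?_) ?_) ?_ <;>
    rw [interior_rect hF.left_ne hF.right_ne, Set.disjoint_left]
  · rintro X ⟨⟨b1, b2⟩, b3, b4⟩ ⟨⟨a1, a2⟩, a3, a4⟩
    linarith
  · rintro X ⟨⟨b1, b2⟩, b3, b4⟩ (⟨⟨a1, a2⟩, a3, a4⟩ | ⟨⟨a1, a2⟩, a3, a4⟩) <;> linarith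
  · rintro X ⟨⟨b1, b2⟩, b3, b4⟩ (⟨⟨a1, a2⟩, a3, a4⟩ | ⟨⟨a1, a2⟩, a3, a4⟩ | ⟨⟨a1, a2⟩, a3, a4⟩) <;>
      linarith

theorem canBeCut_of_combination (hF : Frame d₁ d₂) (c : Plane) {u v : ℝ} (hv : 0 < v)
    (huv : v < u) (hr : 0 < r) {α β : ℚ} (hα : 0 ≤ α) (hβ : 0 ≤ β) (hαβ : 0 < α + β)
    (h : (u + v) / (u - v) = α * r + β * r⁻¹) : CanBeCut (squareWithHole c d₁ d₂ u v) r := by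
  have ht : 0 < (u - v) / 2 := by linarith
  have e : (u + v) / 2 = (α * r + β * r⁻¹) * ((u - v) / 2) := by
    rw [← h]
    have : u - v ≠ 0 := by linarith
    field_simp
  refine canBeCut_squareWithHole hF c hv huv ?_ ?_ <;> rw [e]
  · exact canTile_combination hF hr hα hβ hαβ ht
  · exact canTile_combination hF.symm hr hα hβ hαβ ht

end RectCut

/-! ### The two signs of the conjugate. -/

theorem mainTheorem3 (a b p : ℚ) (hp : 0 < p) (hirr : Irrational (√(p : ℝ)))
    (hr : 0 < (a : ℝ) + b * √(p : ℝ))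
    (u v : ℝ) (hv : 0 < v) (huv : v < u)
    (c d₁ d₂ : RectCut.Plane) (hd₁ : ‖d₁‖ = 1) (hd₂ : ‖d₂‖ = 1) (hd : inner ℝ d₁ d₂ = 0) :
    (0 < (a : ℝ) - b * √(p : ℝ) →
      (RectCut.CanBeCut (RectCut.squareWithHole c d₁ d₂ u v) ((a : ℝ) + b * √(p : ℝ)) ↔
        (u + v) / (u - v) ∈
          {y : ℝ | ∃ e f : ℚ, y = (e : ℝ) + f * √(p : ℝ) ∧ 0 < e ∧ |f| / e ≤ |b| / a})) ∧
    ((a : ℝ) - b * √(p : ℝ) < 0 →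
      (RectCut.CanBeCut (RectCut.squareWithHole c d₁ d₂ u v) ((a : ℝ) + b * √(p : ℝ)) ↔
        (u + v) / (u - v) ∈
          {y : ℝ | ∃ e f : ℚ, y = (e : ℝ) + f * √(p : ℝ) ∧ 0 < f ∧ |e| / f ≤ |a| / b})) := by
  have hF : RectCut.Frame d₁ d₂ := ⟨by rw [real_inner_self_eq_norm_sq, hd₁, one_pow],
    by rw [real_inner_self_eq_norm_sq, hd₂, one_pow], hd⟩
  have hp' : (0 : ℝ) < p := by exact_mod_cast hp
  have hqp : √(p : ℝ) * √(p : ℝ) = p := Real.mul_self_sqrt hp'.le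
  have hq0 : 0 < √(p : ℝ) := Real.sqrt_pos.2 hp'
  have hK : 0 < (u + v) / (u - v) := div_pos (by linarith) (by linarith)
  generalize √(p : ℝ) = q at *
  refine ⟨fun hr' => ?_, fun hr' => ?_⟩
  · have ha : (0 : ℝ) < a := by linarith
    have haq : 0 < a := by exact_mod_cast ha
    have hN : (p : ℝ) * b ^ 2 < a ^ 2 := by nlinarith [mul_pos hr hr']
    have hNq : p * b ^ 2 < a ^ 2 := by exact_mod_cast hN
    constructor
    · intro h
      have h₀ := RectCut.admissible_trace ha hp' hN
      obtain ⟨e, f, hef, H⟩ := h.exists_ratio hF hirr hqp hv huv h₀ (by norm_num)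
      have he := H _ _ _ h₀
      have hle := RectCut.le_of_admissible ha hN H
      have hleq : a * |f| ≤ |b| * e := by exact_mod_cast hle
      have he0 : 0 ≤ e := by
        have : (0 : ℝ) ≤ e := by linarith
        exact_mod_cast this
      -- If `e` were zero the bound would force `f = 0`, contradicting the positivity of the ratio.
      have hepos : 0 < e := by
        refine lt_of_le_of_ne he0 fun h0 => hK.ne' ?_
        rw [← h0, mul_zero] at hleq
        have : f = 0 := abs_nonpos_iff.1 (nonpos_of_mul_nonpos_right hleq haq)
        rw [hef, ← h0, this]
        simp
      refine ⟨e, f, hef, hepos, ?_⟩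
      rw [div_le_div_iff₀ hepos haq]
      linarith
    · rintro ⟨e, f, hef, he, hle⟩
      rw [div_le_div_iff₀ he haq] at hle
      -- When `b = 0` the hypothesis forces `f = 0`, so the convention `f / 0 = 0` is harmless.
      have hfb : f / b * b = f := by
        refine div_mul_cancel_of_imp fun hb => ?_
        rw [hb, abs_zero, zero_mul] at hle
        exact abs_nonpos_iff.1 (nonpos_of_mul_nonpos_left hle haq)
      have habs : |f / b| ≤ e / a := by
        rw [abs_div]
        refine div_le_of_le_mul₀ (abs_nonneg b) (by positivity) ?_
        rw [div_mul_eq_mul_div, le_div_iff₀ haq]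
        linarith
      obtain ⟨l1, l2⟩ := abs_le.1 habs
      have hea : e / a * a = e := div_mul_cancel₀ _ haq.ne'
      have hpos : 0 < e / a := div_pos he haq
      have hM : 0 < a ^ 2 - p * b ^ 2 := by linarith
      -- Solve `e + f * q = α * (a + b * q) + β' * (a - b * q)`, so that `α + β' = e / a` and `α -
      -- β' = f / b`; the norm factor in `β` converts `a - b * q` into `r⁻¹`.
      refine RectCut.canBeCut_of_combination hF c hv huv hr
        (α := (e / a + f / b) / 2) (β := (e / a - f / b) / 2 * (a ^ 2 - p * b ^ 2))
        (by linarith) (mul_nonneg (by linarith) hM.le) ?_ ?_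
      · rcases l1.eq_or_lt with h | h
        · rw [← h]
          have := mul_pos hpos hM
          nlinarith
        · have : 0 ≤ (e / a - f / b) / 2 * (a ^ 2 - p * b ^ 2) :=
            mul_nonneg (by linarith) hM.le
          linarith
      · have hinv : ((a ^ 2 - p * b ^ 2 : ℚ) : ℝ) * (a + b * q)⁻¹ = a - b * q := by
          rw [← div_eq_mul_inv, div_eq_iff hr.ne']
          push_cast
          rw [← hqp]; ring
        rw [Rat.cast_mul, mul_assoc, hinv, hef]
        generalize e / a = E at *
        generalize f / b = G at *
        rw [← hea, ← hfb]
        push_cast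
        ring
  · have hb : (0 : ℝ) < b := by nlinarith
    have hbq : 0 < b := by exact_mod_cast hb
    have hN : (a : ℝ) ^ 2 < p * b ^ 2 := by nlinarith [mul_neg_of_pos_of_neg hr hr']
    have hNq : a ^ 2 < p * b ^ 2 := by exact_mod_cast hN
    constructor
    · intro h
      have h₀ := RectCut.admissible_trace_sqrt hb hN
      obtain ⟨e, f, hef, H⟩ := h.exists_ratio hF hirr hqp hv huv h₀ (by norm_num)
      have hf := H _ _ _ h₀
      have hle := RectCut.le_of_admissible_sqrt hb hN H
      have hleq : b * |e| ≤ |a| * f := by exact_mod_cast hle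
      have hf0 : 0 ≤ f := by
        have : (0 : ℝ) ≤ f := by linarith
        exact_mod_cast this
      have hfpos : 0 < f := by
        refine lt_of_le_of_ne hf0 fun h0 => hK.ne' ?_
        rw [← h0, mul_zero] at hleq
        have : e = 0 := abs_nonpos_iff.1 (nonpos_of_mul_nonpos_right hleq hbq)
        rw [hef, ← h0, this]
        simp
      refine ⟨e, f, hef, hfpos, ?_⟩
      rw [div_le_div_iff₀ hfpos hbq]
      linarith
    · rintro ⟨e, f, hef, hf, hle⟩
      rw [div_le_div_iff₀ hf hbq] at hle
      have hea : e / a * a = e := by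
        refine div_mul_cancel_of_imp fun ha => ?_
        rw [ha, abs_zero, zero_mul] at hle
        exact abs_nonpos_iff.1 (nonpos_of_mul_nonpos_left hle hbq)
      have habs : |e / a| ≤ f / b := by
        rw [abs_div]
        refine div_le_of_le_mul₀ (abs_nonneg a) (by positivity) ?_
        rw [div_mul_eq_mul_div, le_div_iff₀ hbq]
        linarith
      obtain ⟨l1, l2⟩ := abs_le.1 habs
      have hfb : f / b * b = f := div_mul_cancel₀ _ hbq.ne'
      have hpos : 0 < f / b := div_pos hf hbq
      have hM : 0 < p * b ^ 2 - a ^ 2 := by linarith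
      -- The same system with `b * q - a`, now the positive multiple of `r⁻¹`: the sum is `f / b`
      -- and the difference `e / a`.
      refine RectCut.canBeCut_of_combination hF c hv huv hr
        (α := (f / b + e / a) / 2) (β := (f / b - e / a) / 2 * (p * b ^ 2 - a ^ 2))
        (by linarith) (mul_nonneg (by linarith) hM.le) ?_ ?_
      · rcases l1.eq_or_lt with h | h
        · rw [← h]
          have := mul_pos hpos hM
          nlinarith
        · have : 0 ≤ (f / b - e / a) / 2 * (p * b ^ 2 - a ^ 2) :=
            mul_nonneg (by linarith) hM.le
          linarith
      · have hinv : ((p * b ^ 2 - a ^ 2 : ℚ) : ℝ) * (a + b * q)⁻¹ = b * q - a := by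
          rw [← div_eq_mul_inv, div_eq_iff hr.ne']
          push_cast
          rw [← hqp]; ring
        rw [Rat.cast_mul, mul_assoc, hinv, hef]
        generalize e / a = E at *
        generalize f / b = G at *
        rw [← hea, ← hfb]
        push_cast
        ring
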